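/- An ordered rooted tree is a finite rooted tree (at least one node) in which the children of every node are linearly ordered. A generator of such a tree is a leaf (node of outdegree $0$) or a node of outdegree $1$. For $n\ge 1$ let $\mathcal{T}_n$ be the set of ordered rooted trees with exactly $n$ generators. Let $(s_m)_{m\ge 0}=1,1,3,11,45,197,\dots$ be the little Schröder numbers (OEIS A001003), and let $\mathfrak{D}^{\mathbf s}_n$ be the set of Dyck paths of semilength $n$ in which every ascent (maximal run of up-steps) of length $j$ is colored with one of $s_{j-1}$ colors. For $0\le k\le n$ let $$B_{n,k}(z_1,\dots,z_{n-k+1})=\sum_{\alpha}\frac{n!}{\alpha_1!\alpha_2!\cdots}\Big(\frac{z_1}{1!}\Big)^{\alpha_1}\Big(\frac{z_2}{2!}\Big)^{\alpha_2}\cdots$$ be the partial Bell polynomial, the sum being over all $\alpha\in\mathbb{N}_0^{\,n-k+1}$ with $\sum_i\alpha_i=k$ and $\sum_i i\,\alpha_i=n$. Then for every $n\ge 1$ the sets $\mathcal{T}_n$ and $\mathfrak{D}^{\mathbf s}_n$ are finite and $$\#\mathcal{T}_n=\#\mathfrak{D}^{\mathbf s}_n=1+\sum_{k=1}^{n-1}\sum_{j=1}^{n-k}\frac1j\binom{n}{k-1}\binom{n-k-1}{j-1}\binom{n+j-1}{j-1}.$$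 For $n=1,\dots,8$ these numbers are $1,2,7,32,166,926,5419,32816$. Moreover, for every $n\ge1$ and $k\ge 1$, the number of trees in $\mathcal{T}_n$ with exactly $k-1$ nodes of outdegree $1$ equals the number of paths in $\mathfrak{D}^{\mathbf s}_n$ with exactly $k$ peaks (up-steps immediately followed by a down-step). For $1\le k\le n$ this number is $$\binom{n}{k-1}\frac{(k-1)!}{n!}\,B_{n,k}(1!s_0,2!s_1,3!s_2,\dots),$$ and for $1\le k<n$ it equals $$\binom{n}{k-1}\sum_{j=1}^{n-k}\frac1j\binom{n-k-1}{j-1}\binom{n+j-1}{j-1}.$$ -/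

import Mathlib

/-- Finite ordered rooted trees: a root together with the (possibly empty) ordered list of the
subtrees hanging from its children. -/
inductive OrderedTree : Type
  | node (children : List OrderedTree) : OrderedTree

namespace OrderedTree

/-- The list of the outdegrees (numbers of children) of all nodes of a tree, one entry for each
node, in preorder. -/
def outdegrees : OrderedTree → List ℕ
  | node ts => ts.length :: ts.flatMap fun t => t.outdegrees

/-- The number of generators of a tree; a generator is a leaf (a node of outdegree `0`) or a node
of outdegree `1`. -/
def numGenerators (t : OrderedTree) : ℕ :=
  t.outdegrees.countP fun d => d = 0 ∨ d = 1

/-- The number of nodes of outdegree `1`. -/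
def numUnary (t : OrderedTree) : ℕ :=
  t.outdegrees.count 1

/-- The set of ordered rooted trees with `n` generators. -/
def withGenerators (n : ℕ) : Set OrderedTree :=
  {t | t.numGenerators = n}

end OrderedTree

/-- The little Schröder numbers `s 0, s 1, s 2, … = 1, 1, 3, 11, 45, 197, …` (OEIS A001003).
The index of Mathlib's sequence `Nat.smallSchroder`, which reads `1, 1, 1, 3, 11, …`, is larger
by one. -/
def littleSchroder (n : ℕ) : ℕ :=
  Nat.smallSchroder (n + 1)

/-- The lengths of the ascents (maximal runs of up-steps) of a Dyck path, from left to right: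
cut the word at every down-step and discard the empty pieces. -/
def dyckAscents (p : DyckWord) : List ℕ :=
  ((p.toList.splitOn DyckStep.D).map List.length).filter fun j => 0 < j

/-- The number of peaks of a Dyck path: the number of up-steps immediately followed by a
down-step. -/
def dyckPeaks (p : DyckWord) : ℕ :=
  (p.toList.zip p.toList.tail).count (DyckStep.U, DyckStep.D)

/-- A Dyck path in which every ascent of length `j` carries one of `c j` colors. -/
structure ColoredDyckPath (c : ℕ → ℕ) where
  /-- The underlying Dyck path. -/
  path : DyckWord
  /-- The colors of its ascents. -/
  color : (i : Fin (dyckAscents path).length) → Fin (c ((dyckAscents path).get i))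

/-- The set of Dyck paths of semilength `n` in which every ascent of length `j` carries one of
`s (j - 1)` colors, where `s` is the sequence of little Schröder numbers. (Ascents have positive
length.) -/
def schroderDyckPaths (n : ℕ) : Set (ColoredDyckPath fun j => littleSchroder (j - 1)) :=
  {P | P.path.semilength = n}

/-- The value `B_{n,k}(z 1, …, z (n - k + 1))` of the partial exponential Bell polynomial, for
`k ≤ n`: the sum of `n! / (α₁! α₂! ⋯) * (z 1 / 1!) ^ α₁ * (z 2 / 2!) ^ α₂ * ⋯` over all
multi-indices `α` on `{1, …, n - k + 1}` with `∑ αᵢ = k` and `∑ i * αᵢ = n`. -/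
def partialBell (n k : ℕ) (z : ℕ → ℚ) : ℚ :=
  ∑ α ∈ (Finset.piAntidiag (Finset.Icc 1 (n - k + 1)) k).filter
      (fun α : ℕ → ℕ => ∑ i ∈ Finset.Icc 1 (n - k + 1), i * α i = n),
    (n.factorial : ℚ) / (∏ i ∈ Finset.Icc 1 (n - k + 1), ((α i).factorial : ℚ)) *
      ∏ i ∈ Finset.Icc 1 (n - k + 1), (z i / (i.factorial : ℚ)) ^ α i

/-!
Let `F` be the generating function of ordered trees in which `x` marks the generators and `y` the
nodes of outdegree `1`. Then `F = x (1 + y F) + F² / (1 - F)`, that is, `F = x (1 + y F) C(F)` with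
`C(z) = (1 - z) / (1 - 2 z)`. By Lagrange inversion, `n` times the number of trees with `n`
generators and `k - 1` unary nodes is `binom(n, k - 1) [zⁿ⁻ᵏ] Cⁿ`, and expanding
`C = 1 / (1 - z / (1 - z))` gives the sum over `j`.

The numbers of up-steps before, between and after the down-steps of a Dyck path of semilength `n`
form a Łukasiewicz word of length `n + 1` whose nonzero letters are the ascents. With `S` the
generating function of the little Schröder numbers, Lagrange inversion for the trees they encode
shows that `n + 1` times the number of colored paths with `k` peaks is `binom(n + 1, k)
[zⁿ] (z S)ᵏ`. The multinomial expansion of this power is the Bell polynomial. Finally the quadratic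
equation of `S` says `z S = z C(z S)`, so a third inversion gives
`n [zⁿ] (z S)ᵏ = k [zⁿ⁻ᵏ] Cⁿ`, and the two counts agree.
-/

section ForestArray

open PowerSeries Finset

variable {R : Type*} [CommRing R]

theorem coeff_X_mul_derivative (f : R⟦X⟧) (n : ℕ) :
    coeff n (X * derivative R f) = n * coeff n f := by
  cases n with
  | zero => simp
  | succ n => rw [coeff_succ_X_mul, coeff_derivative]; push_cast; ring

theorem coeff_mul_subst_eq_sum {r N M : ℕ} {A B : R⟦X⟧} (hA : X ∣ A) (hB : X ^ r ∣ B)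
    (hM : N < r + M) (f : R⟦X⟧) :
    coeff N (B * f.subst A) = ∑ d ∈ range M, coeff d f * coeff N (B * A ^ d) := by
  have hsubst : HasSubst A := HasSubst.of_constantCoeff_zero' (X_dvd_iff.1 hA)
  have htail (h : R⟦X⟧) : coeff N (B * (A ^ M * h)) = 0 := by
    refine X_pow_dvd_iff.1 ?_ N hM
    rw [← mul_assoc, pow_add]
    exact (mul_dvd_mul hB (pow_dvd_pow_of_dvd hA M)).mul_right h
  conv_lhs => rw [eq_X_pow_mul_shift_add_trunc M f]
  rw [subst_add hsubst, subst_mul hsubst, subst_pow hsubst, subst_X hsubst, mul_add, map_add,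
    htail, zero_add, subst_coe hsubst, Polynomial.aeval_def, eval₂_trunc_eq_sum_range, mul_sum,
    map_sum]
  refine sum_congr rfl fun d _ => ?_
  rw [← coeff_C_mul, mul_left_comm]
  rfl

theorem coeff_X_pow_mul_eq_sum {r N M : ℕ} (hM : N < r + M) (f g : R⟦X⟧) :
    coeff N (X ^ r * (f * g)) = ∑ d ∈ range M, coeff d f * coeff N (X ^ (r + d) * g) := by
  have h := coeff_mul_subst_eq_sum (A := X) (B := X ^ r * g) dvd_rfl (dvd_mul_right _ _) hM f
  rw [X_subst] at h
  rw [mul_left_comm, mul_comm, h]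
  exact sum_congr rfl fun d _ => by rw [mul_right_comm, pow_add]

/-- The array of the coefficients of `x ^ N` in `F ^ r`, where `F` is the solution of
`F = x * W(F) + U(F)`. Combinatorially, `a r N` is the weighted number of ordered forests of `r`
trees with `N` marked nodes, a marked node of outdegree `d` having the weight `coeff d W` and an
unmarked one the weight `coeff d U`; the recurrence removes the root of the first tree. -/
structure IsForestArray (W U : R⟦X⟧) (a : ℕ → ℕ → R) : Prop where
  zero_zero : a 0 0 = 1
  zero_succ (N : ℕ) : a 0 (N + 1) = 0
  eq_zero_of_lt {r N : ℕ} : N < r → a r N = 0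
  succ_succ (r N : ℕ) : a (r + 1) (N + 1) =
    ∑ d ∈ range (N + 2), (coeff d W * a (r + d) N + coeff d U * a (r + d) (N + 1))

/-- The power series `H` for which Lagrange inversion takes the division-free form
`[x ^ N] F ^ r = [z ^ N] (z ^ r * H)`, where `F = x * φ(F)`. -/
noncomputable def lagrangeSeries (φ : R⟦X⟧) : ℕ → R⟦X⟧
  | 0 => 1
  | N + 1 => φ ^ N * (φ - X * derivative R φ)

theorem natCast_mul_coeff_lagrangeSeries (φ : R⟦X⟧) (r N : ℕ) :
    (N : R) * coeff N (X ^ r * lagrangeSeries φ N) = r * coeff N (X ^ r * φ ^ N) := by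
  cases N with
  | zero => cases r <;> simp
  | succ N =>
    have hderiv : X * derivative R (X ^ r * φ ^ (N + 1)) =
        r • (X ^ r * φ ^ (N + 1)) + (N + 1) • (X ^ r * (φ ^ N * (X * derivative R φ))) := by
      rw [Derivation.leibniz, derivative_pow, derivative_pow]
      cases r <;> simp <;> ring
    have hcoeff := congrArg (coeff (N + 1)) hderiv
    rw [coeff_X_mul_derivative, map_add, map_nsmul, map_nsmul, nsmul_eq_mul, nsmul_eq_mul] at hcoeff
    rw [lagrangeSeries, mul_sub, mul_sub, map_sub, ← pow_succ]
    linear_combination hcoeff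

theorem lagrangeSeries_add_two (φ : R⟦X⟧) (N : ℕ) :
    lagrangeSeries φ (N + 2) = φ * lagrangeSeries φ (N + 1) := by
  simp only [lagrangeSeries]; ring

theorem coeff_lagrangeSeries_self [IsAddTorsionFree R] (φ : R⟦X⟧) (N : ℕ) :
    coeff (N + 1) (lagrangeSeries φ (N + 1)) = 0 := by
  have h := natCast_mul_coeff_lagrangeSeries φ 0 (N + 1)
  rw [pow_zero, one_mul, Nat.cast_zero, zero_mul, ← nsmul_eq_mul] at h
  exact (nsmul_eq_zero_iff.1 h).resolve_right N.succ_ne_zero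

namespace IsForestArray

variable {W U φ : R⟦X⟧} {a : ℕ → ℕ → R}

theorem unique {b : ℕ → ℕ → R} (ha : IsForestArray W U a) (hb : IsForestArray W U b)
    (hU : X ^ 2 ∣ U) : a = b := by
  suffices ∀ N r, a r N = b r N from funext₂ fun r N => this N r
  intro N
  induction N with
  | zero =>
    intro r
    cases r with
    | zero => rw [ha.zero_zero, hb.zero_zero]
    | succ r => rw [ha.eq_zero_of_lt r.succ_pos, hb.eq_zero_of_lt r.succ_pos]
  | succ N ihN =>
    intro r
    induction hm : N + 2 - r using Nat.strong_induction_on generalizing r with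
    | _ m ihr =>
    rcases lt_or_ge (N + 1) r with hr | hr
    · rw [ha.eq_zero_of_lt hr, hb.eq_zero_of_lt hr]
    cases r with
    | zero => rw [ha.zero_succ, hb.zero_succ]
    | succ r =>
      rw [ha.succ_succ, hb.succ_succ]
      refine sum_congr rfl fun d _ => ?_
      rw [ihN]
      rcases lt_or_ge d 2 with hd | hd
      · rw [X_pow_dvd_iff.1 hU d hd, zero_mul, zero_mul]
      · rw [ihr _ (by lia) (r + d) rfl]

end IsForestArray

-- `hφ` says `φ = W / (1 - U / X)`, which turns `F = x * W(F) + U(F)` into `F = x * φ(F)`.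
theorem isForestArray_lagrangeSeries [IsAddTorsionFree R] {W U φ : R⟦X⟧} (hU : X ^ 2 ∣ U)
    (hφ : φ * X = X * W + φ * U) :
    IsForestArray W U fun r N => coeff N (X ^ r * lagrangeSeries φ N) where
  zero_zero := by simp [lagrangeSeries]
  zero_succ N := by rw [pow_zero, one_mul, coeff_lagrangeSeries_self]
  eq_zero_of_lt h := by rw [coeff_X_pow_mul', if_neg (by lia)]
  succ_succ r N := by
    rw [sum_add_distrib, ← coeff_X_pow_mul_eq_sum (by lia),
      ← coeff_X_pow_mul_eq_sum (by lia)]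
    cases N with
    | zero =>
      obtain ⟨V, rfl⟩ := hU
      have hφW : φ = W + X * (φ * V) := X_mul_cancel (by linear_combination hφ)
      have hroot : X ^ (r + 1) * (φ - X * derivative R φ) =
          X * (X ^ r * W + X * (X ^ r * (φ * V - derivative R φ))) := by
        linear_combination X ^ (r + 1) * hφW
      have hunmarked (f : R⟦X⟧) : coeff 1 (X ^ r * (X ^ 2 * V * f)) = 0 := by
        rw [show X ^ r * (X ^ 2 * V * f) = X ^ (r + 2) * (V * f) by ring, coeff_X_pow_mul',
          if_neg (by lia)]
      simp only [lagrangeSeries, pow_zero, one_mul, mul_one, zero_add, hunmarked, hroot,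
        coeff_succ_X_mul, map_add, coeff_zero_X_mul, add_zero]
    | succ N =>
      rw [← coeff_succ_X_mul (n := N + 1), ← map_add]
      congr 1
      simp only [lagrangeSeries_add_two]
      linear_combination (X ^ r * lagrangeSeries φ (N + 1)) * hφ

theorem isForestArray_coeff_pow {W U A : R⟦X⟧} (hX : X ∣ A)
    (hA : A = X * W.subst A + U.subst A) : IsForestArray W U fun r N => coeff N (A ^ r) where
  zero_zero := by simp
  zero_succ N := by simp [coeff_one]
  eq_zero_of_lt h := X_pow_dvd_iff.1 (pow_dvd_pow_of_dvd hX _) _ h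
  succ_succ r N := by
    have hAr : X ^ r ∣ A ^ r := pow_dvd_pow_of_dvd hX r
    conv_lhs => rw [pow_succ]; enter [2, 2]; rw [hA]
    rw [mul_add, mul_left_comm, map_add, coeff_succ_X_mul,
      coeff_mul_subst_eq_sum hX hAr (by lia : N < r + (N + 2)),
      coeff_mul_subst_eq_sum hX hAr (by lia : N + 1 < r + (N + 2)), ← sum_add_distrib]
    simp only [pow_add]

theorem IsForestArray.natCast_mul_eq [IsAddTorsionFree R] {W U φ : R⟦X⟧} {a : ℕ → ℕ → R}
    (ha : IsForestArray W U a) (hU : X ^ 2 ∣ U) (hφ : φ * X = X * W + φ * U) (r N : ℕ) :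
    (N : R) * a r N = r * coeff N (X ^ r * φ ^ N) := by
  rw [ha.unique (isForestArray_lagrangeSeries hU hφ) hU, natCast_mul_coeff_lagrangeSeries]

end ForestArray

/-- `IsLukasiewicz r l` says that `l` lists the outdegrees of the nodes of an ordered forest of `r`
trees in preorder: reading a letter `d` replaces the first tree by the `d` trees hanging from its
root. -/
inductive IsLukasiewicz : ℕ → List ℕ → Prop
  | nil : IsLukasiewicz 0 []
  | cons {r d : ℕ} {l : List ℕ} : IsLukasiewicz (r + d) l → IsLukasiewicz (r + 1) (d :: l)

namespace IsLukasiewicz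

variable {r d : ℕ} {l : List ℕ}

@[simp]
theorem zero_iff : IsLukasiewicz 0 l ↔ l = [] :=
  ⟨by rintro ⟨⟩; rfl, by rintro rfl; exact nil⟩

@[simp]
theorem nil_iff : IsLukasiewicz r [] ↔ r = 0 :=
  ⟨by rintro ⟨⟩; rfl, by rintro rfl; exact nil⟩

theorem succ_iff : IsLukasiewicz (r + 1) l ↔ ∃ d l', l = d :: l' ∧ IsLukasiewicz (r + d) l' :=
  ⟨by rintro ⟨⟩; exact ⟨_, _, rfl, ‹_›⟩, by rintro ⟨d, l', rfl, h⟩; exact h.cons⟩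

@[simp]
theorem succ_cons_iff : IsLukasiewicz (r + 1) (d :: l) ↔ IsLukasiewicz (r + d) l :=
  ⟨by rintro ⟨⟩; assumption, cons⟩

theorem add_sum_eq_length (h : IsLukasiewicz r l) : r + l.sum = l.length := by
  induction h with
  | nil => rfl
  | cons _ ih => rw [List.sum_cons, List.length_cons, ← ih]; ring

theorem getLast_eq_zero (h : IsLukasiewicz r l) (hl : l ≠ []) : l.getLast hl = 0 := by
  induction h with
  | nil => contradiction
  | @cons r d l h ih =>
    cases l with
    | nil => exact (Nat.add_eq_zero_iff.1 (nil_iff.1 h)).2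
    | cons e l => rw [List.getLast_cons_cons, ih]

variable {p : ℕ → Prop} [DecidablePred p]

theorem length_add_le (hp : ∀ d ≤ 1, p d) (h : IsLukasiewicz r l) :
    l.length + r ≤ 2 * l.countP p := by
  induction h with
  | nil => rfl
  | @cons r d l _ ih =>
    rw [List.length_cons]
    by_cases hd : p d
    · rw [List.countP_cons_of_pos (by simpa using hd)]
      lia
    · rw [List.countP_cons_of_neg (by simpa using hd)]
      have : ¬d ≤ 1 := fun h => hd (hp d h)
      lia

theorem add_countP_le {q : ℕ → Prop} [DecidablePred q] (hp : p 0) (hq : ¬q 0)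
    (hqp : ∀ d, q d → p d) (h : IsLukasiewicz r l) : r + l.countP q ≤ l.countP p := by
  induction h with
  | nil => rfl
  | @cons r d l _ ih =>
    rw [List.countP_cons, List.countP_cons]
    rcases Nat.eq_zero_or_pos d with rfl | hd
    · simp only [hp, hq, decide_true, decide_false, if_true, Bool.false_eq_true, if_false]
      lia
    · by_cases hqd : q d
      · simp only [hqd, hqp d hqd, decide_true, if_true]
        lia
      · simp only [hqd, decide_false, Bool.false_eq_true, if_false]
        lia

theorem le_countP (hp : p 0) (h : IsLukasiewicz r l) : r ≤ l.countP p :=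
  (Nat.le_add_right _ _).trans
    (h.add_countP_le (q := fun _ => False) hp not_false fun _ => False.elim)

end IsLukasiewicz

theorem finite_isLukasiewicz_countP {p : ℕ → Prop} [DecidablePred p] (hp : ∀ d ≤ 1, p d)
    (r N : ℕ) : {l | IsLukasiewicz r l ∧ l.countP p = N}.Finite := by
  refine ((List.finite_length_le (Fin (2 * N + 1)) (2 * N)).image (List.map Fin.val)).subset ?_
  rintro l ⟨hl, rfl⟩
  have hlength := hl.length_add_le hp
  have hletter (d) (hd : d ∈ l) : d < 2 * l.countP p + 1 := by
    have := List.le_sum_of_mem hd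
    have := hl.add_sum_eq_length
    lia
  obtain ⟨l', hl'⟩ : ∃ l' : List (Fin (2 * l.countP p + 1)), l'.map Fin.val = l :=
    CanLift.prf l hletter
  exact ⟨l', by simpa [← hl'] using le_self_add.trans hlength, hl'⟩

/-- The outdegree sequences of the forests of `r` trees with `N` marked nodes, where the marked
outdegrees are the `d` with `p d`. Only finitely many exist since `0` and `1` are marked. -/
noncomputable def lukasiewiczWords {p : ℕ → Prop} [DecidablePred p] (hp : ∀ d ≤ 1, p d)
    (r N : ℕ) : Finset (List ℕ) :=
  (finite_isLukasiewicz_countP hp r N).toFinset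

section LukasiewiczWords

open PowerSeries Finset

variable {p : ℕ → Prop} [DecidablePred p] (hp : ∀ d ≤ 1, p d) {r N : ℕ} {l : List ℕ}

@[simp]
theorem mem_lukasiewiczWords :
    l ∈ lukasiewiczWords hp r N ↔ IsLukasiewicz r l ∧ l.countP p = N := by
  simp [lukasiewiczWords]

theorem lukasiewiczWords_succ_succ (r N : ℕ) :
    lukasiewiczWords hp (r + 1) (N + 1) = (range (N + 2)).biUnion fun d =>
      (lukasiewiczWords hp (r + d) (if p d then N else N + 1)).image (List.cons d) := by
  ext l
  simp only [mem_lukasiewiczWords, mem_biUnion, mem_range, mem_image, IsLukasiewicz.succ_iff]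
  constructor
  · rintro ⟨⟨d, l, rfl, hl⟩, hN⟩
    have hd := hl.le_countP (hp 0 zero_le_one)
    rw [List.countP_cons] at hN
    exact ⟨d, by lia, l, ⟨hl, by split_ifs <;> simp_all⟩, rfl⟩
  · rintro ⟨d, -, l, ⟨hl, hN⟩, rfl⟩
    refine ⟨⟨d, l, rfl, hl⟩, ?_⟩
    rw [List.countP_cons, hN]
    split_ifs <;> simp_all

variable {R : Type*} [CommRing R]

theorem isForestArray_sum_lukasiewiczWords (w : ℕ → R) {W U : R⟦X⟧}
    (hW : ∀ d, coeff d W = if p d then w d else 0) (hU : ∀ d, coeff d U = if p d then 0 else w d) :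
    IsForestArray W U fun r N => ∑ l ∈ lukasiewiczWords hp r N, (l.map w).prod where
  zero_zero := by
    have : lukasiewiczWords hp 0 0 = {[]} := by ext l; simp +contextual
    simp [this]
  zero_succ N := by
    have : lukasiewiczWords hp 0 (N + 1) = ∅ := by ext l; simp +contextual
    simp [this]
  eq_zero_of_lt {r N} h := by
    refine sum_eq_zero fun l hl => absurd h ?_
    obtain ⟨hword, rfl⟩ := (mem_lukasiewiczWords hp).1 hl
    exact (hword.le_countP (hp 0 zero_le_one)).not_gt
  succ_succ r N := by
    rw [lukasiewiczWords_succ_succ, sum_biUnion]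
    · refine sum_congr rfl fun d _ => ?_
      rw [sum_image fun _ _ _ _ h => List.cons_injective h, hW, hU]
      split_ifs <;> simp [mul_sum]
    · intro d _ e _ hde
      refine disjoint_left.2 fun l hd he => hde ?_
      obtain ⟨_, -, rfl⟩ := mem_image.1 hd
      obtain ⟨_, -, h⟩ := mem_image.1 he
      exact (List.cons.inj h).1.symm

theorem coeff_coeff_map_C_mul_add_pow (F A B : R⟦X⟧) (m N k : ℕ) :
    (coeff m (map Polynomial.C F *
      (map Polynomial.C A + C Polynomial.X * map Polynomial.C B) ^ N)).coeff k =
      N.choose k * coeff m (F * (A ^ (N - k) * B ^ k)) := by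
  have hterm (i : ℕ) : (coeff m (map Polynomial.C F * ((C Polynomial.X * map Polynomial.C B) ^ i *
      map Polynomial.C A ^ (N - i) * (N.choose i : (Polynomial R)⟦X⟧)))).coeff k =
      if k = i then N.choose i * coeff m (F * (A ^ (N - i) * B ^ i)) else 0 := by
    rw [show map Polynomial.C F * ((C Polynomial.X * map Polynomial.C B) ^ i *
      map Polynomial.C A ^ (N - i) * (N.choose i : (Polynomial R)⟦X⟧)) =
      C (Polynomial.X ^ i) * map Polynomial.C ((N.choose i : R⟦X⟧) * (F * (A ^ (N - i) * B ^ i))) by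
        simp only [map_mul, map_pow, map_natCast]; ring, coeff_C_mul, coeff_map,
      Polynomial.X_pow_mul_C, Polynomial.coeff_C_mul_X_pow, ← map_natCast (C (R := R)),
      coeff_C_mul]
  rw [add_comm, add_pow, mul_sum, map_sum, Polynomial.finsetSum_coeff]
  simp only [hterm, sum_ite_eq, mem_range]
  split_ifs with h
  · rfl
  · rw [Nat.choose_eq_zero_of_lt (by lia), Nat.cast_zero, zero_mul]

theorem coeff_prod_map_mul_ite (q : ℕ → Prop) [DecidablePred q] (c : ℕ → R) (l : List ℕ) (k : ℕ) :
    ((l.map fun d => Polynomial.C (c d) * if q d then Polynomial.X else 1).prod).coeff k =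
      if l.countP q = k then (l.map c).prod else 0 := by
  have hprod : (l.map fun d => Polynomial.C (c d) * if q d then Polynomial.X else 1).prod =
      Polynomial.C (l.map c).prod * Polynomial.X ^ l.countP q := by
    induction l with
    | nil => simp
    | cons d l ih =>
      rw [List.map_cons, List.prod_cons, ih, List.countP_cons]
      by_cases hd : q d <;> simp only [hd, if_true, decide_true, decide_false, reduceCtorEq,
        if_false, List.map_cons, List.prod_cons, map_mul] <;> ring
  rw [hprod, Polynomial.coeff_C_mul_X_pow]
  simp only [eq_comm]

theorem natCast_mul_sum_lukasiewiczWords_countP [IsDomain R] [CharZero R] (c : ℕ → R)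
    {q : ℕ → Prop} [DecidablePred q] (hqp : ∀ d, q d → p d) {W₀ W₁ U ψ : R⟦X⟧}
    (hW₀ : ∀ d, coeff d W₀ = if p d ∧ ¬q d then c d else 0)
    (hW₁ : ∀ d, coeff d W₁ = if q d then c d else 0)
    (hU : ∀ d, coeff d U = if p d then 0 else c d) (hψ : ψ * X = X + ψ * U) (r N k : ℕ) :
    N * ∑ l ∈ lukasiewiczWords hp r N with l.countP q = k, (l.map c).prod =
      r * (N.choose k * coeff N (X ^ r * ((ψ * W₀) ^ (N - k) * (ψ * W₁) ^ k))) := by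
  -- The letters with `q` are marked by a polynomial variable, whose `k`-th coefficient is taken.
  let w (d : ℕ) : Polynomial R := Polynomial.C (c d) * if q d then Polynomial.X else 1
  let W : (Polynomial R)⟦X⟧ := map Polynomial.C W₀ + C Polynomial.X * map Polynomial.C W₁
  have hW (d) : coeff d W = if p d then w d else 0 := by
    rw [map_add, coeff_C_mul, coeff_map, coeff_map, hW₀, hW₁]
    by_cases hqd : q d
    · simp only [w, hqd, hqp d hqd, not_true, and_false, if_true, if_false, map_zero, zero_add]
      exact mul_comm _ _
    · by_cases hpd : p d <;> simp [w, hqd, hpd]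
  have hU' (d) : coeff d (map Polynomial.C U) = if p d then 0 else w d := by
    rw [coeff_map, hU]
    by_cases hpd : p d
    · simp [hpd]
    · have hqd : ¬q d := mt (hqp d) hpd
      simp [w, hpd, hqd]
  have hX2 : X ^ 2 ∣ map Polynomial.C U :=
    X_pow_dvd_iff.2 fun d hd => by rw [hU', if_pos (hp d (by lia))]
  have hφ : map Polynomial.C ψ * W =
      map Polynomial.C (ψ * W₀) + C Polynomial.X * map Polynomial.C (ψ * W₁) := by
    simp only [W, map_mul]; ring
  have hφX : map Polynomial.C ψ * W * X =
      X * W + map Polynomial.C ψ * W * map Polynomial.C U := by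
    have := congrArg (PowerSeries.map Polynomial.C) hψ
    simp only [map_mul, map_add, map_X] at this
    linear_combination W * this
  have hlagrange := congrArg (Polynomial.coeff · k)
    ((isForestArray_sum_lukasiewiczWords hp w hW hU').natCast_mul_eq hX2 hφX r N)
  rw [hφ, ← map_X (Polynomial.C (R := R)), ← map_pow] at hlagrange
  simpa only [w, Polynomial.coeff_natCast_mul, coeff_coeff_map_C_mul_add_pow,
    Polynomial.finsetSum_coeff, coeff_prod_map_mul_ite, ← sum_filter] using hlagrange

end LukasiewiczWords

section CompositionSeries

open PowerSeries
open Finset hiding mk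

/-- The generating function `1 / (1 - X / (1 - X))` of the compositions of integers. -/
noncomputable def compositionSeries (R : Type*) [CommRing R] : R⟦X⟧ :=
  (mk 1 : R⟦X⟧).subst (X * mk 1 : R⟦X⟧)

variable {R : Type*} [CommRing R]

theorem compositionSeries_mul_one_sub_two_mul_X :
    compositionSeries R * (1 - 2 * X) = 1 - X := by
  have hgeom : (mk 1 : R⟦X⟧) * (1 - X) = 1 := mk_one_mul_one_sub_eq_one R
  have hsubst : HasSubst (X * mk 1 : R⟦X⟧) := HasSubst.of_constantCoeff_zero' (by simp)
  have hcomp := congrArg (substAlgHom hsubst) hgeom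
  rw [map_mul, map_sub, map_one, substAlgHom_X, coe_substAlgHom] at hcomp
  change compositionSeries R * (1 - X * mk 1) = 1 at hcomp
  linear_combination (1 - X) * hcomp + X * compositionSeries R * hgeom

theorem coeff_X_mul_mk_one_pow {m j : ℕ} (hj : 1 ≤ j) (hjm : j ≤ m) :
    coeff m ((X * mk 1 : R⟦X⟧) ^ j) = (m - 1).choose (j - 1) := by
  obtain ⟨j, rfl⟩ := Nat.exists_eq_add_of_le' hj
  rw [mul_pow, coeff_X_pow_mul', if_pos hjm, mk_one_pow_eq_mk_choose_add, coeff_mk]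
  congr 2
  lia

theorem coeff_compositionSeries_pow {n m : ℕ} (hn : 1 ≤ n) (hm : 1 ≤ m) :
    coeff m (compositionSeries R ^ n) =
      ∑ j ∈ Icc 1 m, ((n + j - 1).choose j : R) * (m - 1).choose (j - 1) := by
  have hX : X ∣ (X * mk 1 : R⟦X⟧) := dvd_mul_right _ _
  have hexpand := coeff_mul_subst_eq_sum (r := 0) (B := 1) hX (pow_zero (X : R⟦X⟧)).dvd
    (by lia : m < 0 + (m + 1)) (mk 1 ^ n)
  rw [one_mul, subst_pow (HasSubst.of_constantCoeff_zero' (by simp))] at hexpand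
  rw [compositionSeries, hexpand, range_eq_Ico, sum_eq_sum_Ico_succ_bot m.succ_pos,
    Nat.succ_eq_add_one, zero_add, Ico_add_one_right_eq_Icc, pow_zero, mul_one,
    coeff_one, if_neg (by lia), mul_zero, zero_add]
  refine sum_congr rfl fun j hj => ?_
  obtain ⟨hj, hjm⟩ := mem_Icc.1 hj
  obtain ⟨n, rfl⟩ := Nat.exists_eq_add_of_le' hn
  rw [one_mul, coeff_X_mul_mk_one_pow hj hjm, mk_one_pow_eq_mk_choose_add, coeff_mk,
    Nat.choose_symm_add, add_right_comm, add_tsub_cancel_right]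

end CompositionSeries

section LittleSchroderSeries

open PowerSeries

/-- The generating function `1 + X + 3 * X ^ 2 + 11 * X ^ 3 + ⋯` of the little Schröder
numbers. -/
noncomputable def littleSchroderSeries : ℚ⟦X⟧ :=
  mk fun n => (littleSchroder n : ℚ)

theorem littleSchroder_zero : littleSchroder 0 = 1 := by simp [littleSchroder]

theorem two_mul_littleSchroderSeries :
    2 * littleSchroderSeries = 1 + map (Nat.castRingHom ℚ) largeSchroderSeries := by
  ext n
  rw [two_mul, map_add, map_add, ← two_mul, coeff_map, coeff_one, littleSchroderSeries, coeff_mk,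
    coeff_largeSchroderSeries]
  rcases eq_or_ne n 0 with rfl | hn
  · norm_num [littleSchroder_zero]
  · rw [if_neg hn, zero_add, ← Nat.two_mul_smallSchroder_succ hn, littleSchroder]
    simp

theorem littleSchroderSeries_eq :
    littleSchroderSeries =
      1 - X * littleSchroderSeries + 2 * (X * littleSchroderSeries ^ 2) := by
  have hlarge := congrArg (map (Nat.castRingHom ℚ))
    largeSchroderSeries_eq_one_add_X_mul_largeSchroderSeries_add_X_mul_largeSchroderSeries_sq
  rw [map_add, map_add, map_mul, map_mul, map_pow, map_X, map_one,
    ← sub_eq_iff_eq_add'.2 two_mul_littleSchroderSeries] at hlarge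
  have htwo : (2 : ℚ⟦X⟧) ≠ 0 := fun h => by
    simpa only [map_ofNat, map_zero, OfNat.ofNat_ne_zero] using congrArg constantCoeff h
  refine mul_left_cancel₀ htwo ?_
  linear_combination hlarge

theorem natCast_mul_coeff_X_mul_littleSchroderSeries_pow (k n : ℕ) :
    (n : ℚ) * coeff n ((X * littleSchroderSeries) ^ k) =
      k * coeff n (X ^ k * compositionSeries ℚ ^ n) := by
  have hsubst : HasSubst (X * littleSchroderSeries) := HasSubst.of_constantCoeff_zero' (by simp)
  have harray : IsForestArray (1 - X) (2 * X ^ 2)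
      fun r N => coeff N ((X * littleSchroderSeries) ^ r) := by
    refine isForestArray_coeff_pow (dvd_mul_right _ _) ?_
    simp only [← coe_substAlgHom hsubst, map_sub, map_mul, map_pow, map_one, map_ofNat,
      substAlgHom_X]
    linear_combination X * littleSchroderSeries_eq
  refine harray.natCast_mul_eq (dvd_mul_left _ _) ?_ k n
  linear_combination X * compositionSeries_mul_one_sub_two_mul_X (R := ℚ)

end LittleSchroderSeries

namespace OrderedTree

theorem outdegrees_node (ts : List OrderedTree) :
    (node ts).outdegrees = ts.length :: ts.flatMap outdegrees := by
  rw [outdegrees]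

theorem isLukasiewicz_flatMap_outdegrees (ts : List OrderedTree) :
    IsLukasiewicz ts.length (ts.flatMap outdegrees) := by
  generalize hl : ts.flatMap outdegrees = l
  induction l generalizing ts with
  | nil =>
    rcases ts with _ | ⟨⟨cs⟩, ts⟩
    · simp
    · simp [outdegrees_node] at hl
  | cons d l ih =>
    rcases ts with _ | ⟨⟨cs⟩, ts⟩
    · simp at hl
    · simp only [List.flatMap_cons, outdegrees_node, List.cons_append, List.cons.injEq] at hl
      obtain ⟨rfl, hl⟩ := hl
      have hforest := ih (cs ++ ts) (by rw [List.flatMap_append, hl])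
      rw [List.length_append, add_comm] at hforest
      exact hforest.cons

theorem existsUnique_flatMap_outdegrees_eq {r : ℕ} {l : List ℕ} (h : IsLukasiewicz r l) :
    ∃! ts : List OrderedTree, ts.length = r ∧ ts.flatMap outdegrees = l := by
  induction h with
  | nil => exact ⟨[], by simp, fun ts hts => List.length_eq_zero_iff.1 hts.1⟩
  | @cons r d l _ ih =>
    obtain ⟨ts, ⟨hlength, hl⟩, hunique⟩ := ih
    refine ⟨node (ts.take d) :: ts.drop d, ⟨by simp [hlength], ?_⟩, ?_⟩
    · rw [List.flatMap_cons, outdegrees_node, List.cons_append, ← List.flatMap_append,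
        List.take_append_drop, hl, List.length_take, hlength, min_eq_left (by lia)]
    · rintro (_ | ⟨⟨cs⟩, us⟩) ⟨hr, hw⟩
      · simp at hr
      simp only [List.flatMap_cons, outdegrees_node, List.cons_append, List.cons.injEq] at hw
      obtain ⟨rfl, hw⟩ := hw
      obtain rfl : cs ++ us = ts :=
        hunique _ ⟨by rw [List.length_append, ← Nat.succ.inj hr, add_comm],
          by rw [List.flatMap_append, hw]⟩
      simp

theorem isLukasiewicz_outdegrees (t : OrderedTree) : IsLukasiewicz 1 t.outdegrees := by
  simpa using isLukasiewicz_flatMap_outdegrees [t]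

theorem outdegrees_injective : Function.Injective outdegrees := by
  intro t t' h
  have := (existsUnique_flatMap_outdegrees_eq t.isLukasiewicz_outdegrees).unique
    (y₁ := [t]) (y₂ := [t']) (by simp) (by simp [h])
  exact (List.cons.inj this).1

theorem exists_outdegrees_eq {l : List ℕ} (h : IsLukasiewicz 1 l) :
    ∃ t : OrderedTree, t.outdegrees = l := by
  obtain ⟨ts, ⟨hts, hl⟩, -⟩ := existsUnique_flatMap_outdegrees_eq h
  obtain ⟨t, rfl⟩ := List.length_eq_one_iff.1 hts
  exact ⟨t, by simpa using hl⟩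

theorem image_outdegrees_withGenerators (n : ℕ) :
    outdegrees '' withGenerators n =
      lukasiewiczWords (fun _ => Nat.le_one_iff_eq_zero_or_eq_one.1) 1 n := by
  ext l
  simp only [Finset.mem_coe, mem_lukasiewiczWords]
  constructor
  · rintro ⟨t, ht, rfl⟩
    exact ⟨t.isLukasiewicz_outdegrees, ht⟩
  · rintro ⟨hl, hn⟩
    obtain ⟨t, rfl⟩ := exists_outdegrees_eq hl
    exact ⟨t, hn, rfl⟩

theorem finite_withGenerators (n : ℕ) : (withGenerators n).Finite :=
  .of_finite_image (image_outdegrees_withGenerators n ▸ Finset.finite_toSet _)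
    outdegrees_injective.injOn

theorem ncard_withGenerators_numUnary_eq_card (n u : ℕ) :
    {t ∈ withGenerators n | t.numUnary = u}.ncard =
      ((lukasiewiczWords (fun _ => Nat.le_one_iff_eq_zero_or_eq_one.1) 1 n).filter
        fun l => l.countP (· = 1) = u).card := by
  have himage : outdegrees '' {t ∈ withGenerators n | t.numUnary = u} =
      outdegrees '' withGenerators n ∩ {l | l.countP (· = 1) = u} :=
    Set.image_inter_preimage outdegrees (withGenerators n) {l | l.countP (· = 1) = u}
  rw [← Set.ncard_image_of_injective _ outdegrees_injective, himage,
    image_outdegrees_withGenerators, ← Set.ncard_coe_finset, Finset.coe_filter]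
  rfl

theorem numUnary_lt_numGenerators (t : OrderedTree) : t.numUnary < t.numGenerators := by
  have h := t.isLukasiewicz_outdegrees.add_countP_le (p := fun d => d = 0 ∨ d = 1) (q := (· = 1))
    (.inl rfl) zero_ne_one fun _ => .inr
  rwa [add_comm] at h

open PowerSeries in
theorem natCast_mul_ncard_withGenerators_numUnary (n u : ℕ) :
    (n : ℚ) * {t ∈ withGenerators n | t.numUnary = u}.ncard =
      n.choose u * coeff n (X ^ (u + 1) * compositionSeries ℚ ^ n) := by
  have hgeom : (mk 1 : ℚ⟦X⟧) * (1 - X) = 1 := mk_one_mul_one_sub_eq_one ℚ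
  have hwords := natCast_mul_sum_lukasiewiczWords_countP
    (fun _ => Nat.le_one_iff_eq_zero_or_eq_one.1)
    (fun _ => (1 : ℚ)) (q := (· = 1)) (W₀ := 1) (W₁ := X) (U := X ^ 2 * mk 1)
    (ψ := compositionSeries ℚ) (fun _ => .inr) (fun d => ?_) (fun d => coeff_X d) (fun d => ?_) ?_
    1 n u
  · rw [ncard_withGenerators_numUnary_eq_card]
    rcases lt_or_ge n u with hu | hu
    · simpa [Nat.choose_eq_zero_of_lt hu] using hwords
    · have hpow : X ^ 1 * ((compositionSeries ℚ * 1) ^ (n - u) * (compositionSeries ℚ * X) ^ u) =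
          X ^ (u + 1) * compositionSeries ℚ ^ n := by
        conv_rhs => rw [← Nat.sub_add_cancel hu]
        ring
      simpa [← hpow] using hwords
  · rw [coeff_one]
    congr 1
    exact propext (by lia)
  · rw [coeff_X_pow_mul', coeff_mk]
    by_cases hd : 2 ≤ d
    · rw [if_pos hd, if_neg (by lia)]; rfl
    · rw [if_neg hd, if_pos (by lia)]
  · linear_combination X * mk 1 * compositionSeries_mul_one_sub_two_mul_X (R := ℚ) -
      (compositionSeries ℚ * X - X) * hgeom

end OrderedTree

section DyckRuns

open DyckStep

/-- The numbers of up-steps before, between and after the down-steps of a path. For a Dyck path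
these are the outdegrees of an ordered tree in preorder, and the nonzero ones are its ascents. -/
def dyckRuns (s : List DyckStep) : List ℕ :=
  (s.splitOn D).map List.length

@[simp]
theorem dyckRuns_nil : dyckRuns [] = [0] := by simp [dyckRuns]

@[simp]
theorem dyckRuns_D_cons (s : List DyckStep) : dyckRuns (D :: s) = 0 :: dyckRuns s := by
  simp [dyckRuns, List.splitOn_cons_eq_if_modifyHead]

@[simp]
theorem dyckRuns_U_cons (s : List DyckStep) :
    dyckRuns (U :: s) = (dyckRuns s).modifyHead (· + 1) := by
  rw [dyckRuns, List.splitOn_cons_eq_if_modifyHead, if_neg (by decide), dyckRuns]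
  cases s.splitOn D <;> simp

@[simp]
theorem dyckRuns_ne_nil (s : List DyckStep) : dyckRuns s ≠ [] := by
  simp [dyckRuns]

theorem length_dyckRuns (s : List DyckStep) : (dyckRuns s).length = s.count D + 1 := by
  induction s with
  | nil => simp
  | cons x s ih => cases x <;> simp [ih]

theorem map_replicate_dyckRuns (s : List DyckStep) :
    (dyckRuns s).map (List.replicate · U) = s.splitOn D := by
  induction s with
  | nil => simp
  | cons x s ih =>
    rw [List.splitOn_cons_eq_if_modifyHead, ← ih]
    cases x
    · cases h : dyckRuns s <;> simp [h, List.replicate_succ]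
    · simp

theorem dyckRuns_injective : Function.Injective dyckRuns := by
  intro s t h
  have := congrArg (fun l => [D].intercalate (l.map (List.replicate · U))) h
  simpa only [map_replicate_dyckRuns, List.intercalate_splitOn] using this

theorem exists_dyckRuns_eq {l : List ℕ} (hl : l ≠ []) : ∃ s, dyckRuns s = l := by
  refine ⟨[D].intercalate (l.map (List.replicate · U)), ?_⟩
  rw [dyckRuns, List.splitOn_intercalate]
  · simp [Function.comp_def]
  · simp [List.mem_replicate]
  · simpa using hl

theorem isLukasiewicz_modifyHead_add_one {r : ℕ} {l : List ℕ} (hl : l ≠ []) :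
    IsLukasiewicz (r + 1) (l.modifyHead (· + 1)) ↔ IsLukasiewicz (r + 2) l := by
  cases l with
  | nil => contradiction
  | cons d l =>
    rw [List.modifyHead_cons, IsLukasiewicz.succ_cons_iff, IsLukasiewicz.succ_cons_iff,
      add_left_comm, add_comm]

theorem isLukasiewicz_dyckRuns {h : ℕ} {s : List DyckStep} :
    IsLukasiewicz (h + 1) (dyckRuns s) ↔
      h + s.count U = s.count D ∧ ∀ i, (s.take i).count D ≤ h + (s.take i).count U := by
  induction s generalizing h with
  | nil => simp
  | cons x s ih =>
    rw [← Nat.and_forall_add_one]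
    cases x
    · rw [dyckRuns_U_cons, isLukasiewicz_modifyHead_add_one (dyckRuns_ne_nil s), ih]
      simp [add_assoc, add_comm 1]
    · rw [dyckRuns_D_cons, IsLukasiewicz.succ_cons_iff, add_zero]
      cases h with
      | zero => exact iff_of_false (by simp) fun H => by simpa using H.2.2 0
      | succ h =>
        rw [ih]
        simp [add_right_comm]

theorem image_dyckRuns (n : ℕ) :
    (fun p : DyckWord => dyckRuns p.toList) '' {p | p.semilength = n} =
      {l | IsLukasiewicz 1 l ∧ l.length = n + 1} := by
  ext l
  constructor
  · rintro ⟨p, rfl, rfl⟩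
    exact ⟨isLukasiewicz_dyckRuns.2 ⟨by simpa using p.count_U_eq_count_D,
      by simpa using p.count_D_le_count_U⟩, by rw [length_dyckRuns, p.semilength_eq_count_D]⟩
  · rintro ⟨hl, hn⟩
    obtain ⟨s, rfl⟩ := exists_dyckRuns_eq (l := l) (by rintro rfl; simp at hn)
    obtain ⟨hcount, hprefix⟩ := isLukasiewicz_dyckRuns.1 hl
    refine ⟨⟨s, by simpa using hcount, by simpa using hprefix⟩, ?_, rfl⟩
    rw [length_dyckRuns] at hn
    rw [Set.mem_ofPred_eq, DyckWord.semilength]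
    lia

theorem count_U_D_zip_tail : ∀ s : List DyckStep,
    (s.zip s.tail).count (U, D) = (dyckRuns s).dropLast.countP (0 < ·)
  | [] => by simp
  | [U] => by simp
  | D :: s => by
    have ih := count_U_D_zip_tail s
    cases s <;> simp_all [List.dropLast_cons_of_ne_nil]
  | U :: D :: s => by
    have ih := count_U_D_zip_tail (D :: s)
    simp_all [List.dropLast_cons_of_ne_nil]
  | U :: U :: s => by
    have ih := count_U_D_zip_tail (U :: s)
    obtain ⟨d, l, hd⟩ := List.exists_cons_of_ne_nil (dyckRuns_ne_nil s)
    cases l <;> simp_all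

theorem dyckRuns_toList_injective : Function.Injective fun p : DyckWord => dyckRuns p.toList :=
  dyckRuns_injective.comp fun _ _ => DyckWord.ext

theorem isLukasiewicz_dyckRuns_toList (p : DyckWord) : IsLukasiewicz 1 (dyckRuns p.toList) :=
  ((image_dyckRuns _).subset ⟨p, rfl, rfl⟩).1

theorem getLast_dyckRuns_toList (p : DyckWord) :
    (dyckRuns p.toList).getLast (dyckRuns_ne_nil _) = 0 :=
  (isLukasiewicz_dyckRuns_toList p).getLast_eq_zero (dyckRuns_ne_nil _)

theorem dyckPeaks_eq_countP (p : DyckWord) :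
    dyckPeaks p = (dyckRuns p.toList).countP (0 < ·) := by
  rw [dyckPeaks, count_U_D_zip_tail]
  conv_rhs => rw [← List.dropLast_append_getLast (dyckRuns_ne_nil p.toList),
    getLast_dyckRuns_toList]
  simp

theorem dyckPeaks_le_semilength (p : DyckWord) : dyckPeaks p ≤ p.semilength := by
  have hle := (isLukasiewicz_dyckRuns_toList p).add_countP_le (p := fun _ => True) (q := (0 < ·))
    trivial (lt_irrefl 0) fun _ _ => trivial
  rw [← dyckPeaks_eq_countP, decide_true, List.countP_true, length_dyckRuns,
    ← p.semilength_eq_count_D] at hle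
  lia

theorem dyckPeaks_pos {p : DyckWord} (hp : 1 ≤ p.semilength) : 1 ≤ dyckPeaks p := by
  by_contra! h
  have hzero : ∀ d ∈ dyckRuns p.toList, d = 0 := by
    simpa [dyckPeaks_eq_countP] using h
  have := (isLukasiewicz_dyckRuns_toList p).add_sum_eq_length
  rw [List.sum_eq_zero hzero, length_dyckRuns, ← p.semilength_eq_count_D] at this
  lia

theorem finite_dyckWord_semilength_eq (n : ℕ) : {p : DyckWord | p.semilength = n}.Finite :=
  inferInstanceAs (Finite {p : DyckWord // p.semilength = n})

end DyckRuns

namespace ColoredDyckPath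

/-- A colored Dyck path, as a Dyck path together with a color for each of its ascents. -/
def equivSigma (c : ℕ → ℕ) : ColoredDyckPath c ≃
    Σ p : DyckWord, (i : Fin (dyckAscents p).length) → Fin (c ((dyckAscents p).get i)) where
  toFun P := ⟨P.path, P.color⟩
  invFun P := ⟨P.1, P.2⟩

theorem setOf_path_mem_eq_image (c : ℕ → ℕ) (S : Finset DyckWord) :
    {P : ColoredDyckPath c | P.path ∈ S} = (equivSigma c).symm ''
      (S.sigma fun p => (Finset.univ :
        Finset ((i : Fin (dyckAscents p).length) → Fin (c ((dyckAscents p).get i))))) := by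
  ext P
  rw [Equiv.image_symm_eq_preimage]
  simp [equivSigma]

theorem ncard_setOf_path_mem (c : ℕ → ℕ) (S : Finset DyckWord) :
    {P : ColoredDyckPath c | P.path ∈ S}.ncard = ∑ p ∈ S, ((dyckAscents p).map c).prod := by
  rw [setOf_path_mem_eq_image, Set.ncard_image_of_injective _ (Equiv.injective _),
    Set.ncard_coe_finset, Finset.card_sigma]
  refine Finset.sum_congr rfl fun p _ => ?_
  rw [Finset.card_univ, Fintype.card_pi]
  simp only [Fintype.card_fin, List.get_eq_getElem]
  exact Fin.prod_univ_fun_getElem _ c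

theorem finite_semilength_eq (c : ℕ → ℕ) (n : ℕ) :
    {P : ColoredDyckPath c | P.path.semilength = n}.Finite := by
  have := setOf_path_mem_eq_image c (finite_dyckWord_semilength_eq n).toFinset
  simp only [Set.Finite.mem_toFinset, Set.mem_ofPred_eq] at this
  rw [this]
  exact (Finset.finite_toSet _).image _

theorem ncard_semilength_peaks (c : ℕ → ℕ) (n k : ℕ) :
    {P : ColoredDyckPath c | P.path.semilength = n ∧ dyckPeaks P.path = k}.ncard =
      ∑ l ∈ lukasiewiczWords (p := fun _ => True) (fun _ _ => trivial) 1 (n + 1) with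
        l.countP (0 < ·) = k, (l.map fun d => if 0 < d then c d else 1).prod := by
  have hfinite : {p : DyckWord | p.semilength = n ∧ dyckPeaks p = k}.Finite :=
    (finite_dyckWord_semilength_eq n).subset fun p hp => hp.1
  have hncard := ncard_setOf_path_mem c hfinite.toFinset
  simp only [Set.Finite.mem_toFinset, Set.mem_ofPred_eq] at hncard
  rw [hncard]
  refine Finset.sum_bij (fun p _ => dyckRuns p.toList) ?_
    (fun p _ q _ h => dyckRuns_toList_injective h) ?_ ?_
  · intro p hp
    obtain ⟨rfl, rfl⟩ := hfinite.mem_toFinset.1 hp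
    simpa [← dyckPeaks_eq_countP] using (image_dyckRuns _).subset ⟨p, rfl, rfl⟩
  · intro l hl
    rw [Finset.mem_filter, mem_lukasiewiczWords] at hl
    obtain ⟨p, hp, rfl⟩ := (image_dyckRuns n).superset ⟨hl.1.1, by simpa using hl.1.2⟩
    exact ⟨p, hfinite.mem_toFinset.2 ⟨hp, by rw [dyckPeaks_eq_countP, hl.2]⟩, rfl⟩
  · intro p _
    rw [List.prod_map_ite, List.map_const', List.prod_replicate, one_pow, mul_one, dyckAscents,
      dyckRuns]

open PowerSeries in
theorem natCast_mul_ncard_semilength_peaks (c : ℕ → ℕ) (n k : ℕ) :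
    ((n + 1 : ℕ) : ℚ) *
        {P : ColoredDyckPath c | P.path.semilength = n ∧ dyckPeaks P.path = k}.ncard =
      (n + 1).choose k * coeff n ((X * PowerSeries.mk fun j => (c (j + 1) : ℚ)) ^ k) := by
  have hcount := natCast_mul_sum_lukasiewiczWords_countP (R := ℚ) (p := fun _ => True)
    (fun _ _ => trivial) (fun d => ((if 0 < d then c d else 1 : ℕ) : ℚ)) (q := (0 < ·))
    (fun _ _ => trivial) (W₀ := 1)
    (W₁ := X * PowerSeries.mk fun j => (c (j + 1) : ℚ)) (U := 0) (ψ := 1)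
    (fun d => by simp +contextual [coeff_one])
    (fun d => by cases d <;> simp [coeff_succ_X_mul]) (fun d => by simp) (by simp) 1 (n + 1) k
  rw [ncard_semilength_peaks]
  simpa [coeff_succ_X_mul, Function.comp_def] using hcount

end ColoredDyckPath

section PartialBell

open PowerSeries
open Finset hiding mk

variable {R : Type*} [CommSemiring R]

theorem coeff_sum_monomial_pow (s : Finset ℕ) (c : ℕ → R) (n k : ℕ) :
    coeff n ((∑ i ∈ s, monomial i (c i)) ^ k) =
      ∑ α ∈ (s.piAntidiag k).filter fun α : ℕ → ℕ => ∑ i ∈ s, i * α i = n,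
        (Nat.multinomial s α : R) * ∏ i ∈ s, c i ^ α i := by
  have hprod (α : ℕ → ℕ) : ∏ i ∈ s, monomial i (c i) ^ α i =
      monomial (∑ i ∈ s, i * α i) (∏ i ∈ s, c i ^ α i) := by
    simp only [monomial_eq_C_mul_X_pow, mul_pow, prod_mul_distrib, ← pow_mul, map_prod, map_pow,
      prod_pow_eq_pow_sum]
  rw [sum_pow_eq_sum_piAntidiag, map_sum, sum_filter]
  refine sum_congr rfl fun α _ => ?_
  rw [hprod, ← nsmul_eq_mul, map_nsmul, coeff_monomial, nsmul_eq_mul]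
  simp only [eq_comm (a := n), mul_ite, mul_zero]

theorem X_mul_trunc_mk (c : ℕ → R) (m : ℕ) :
    X * (trunc m (mk c) : R⟦X⟧) = ∑ i ∈ Icc 1 m, monomial i (c (i - 1)) := by
  ext i
  rw [map_sum]
  simp only [coeff_monomial, sum_ite_eq, mem_Icc]
  cases i with
  | zero => simp
  | succ i =>
    rw [coeff_succ_X_mul, Polynomial.coeff_coe, coeff_trunc, coeff_mk]
    simp

theorem coeff_X_mul_pow_eq_coeff_X_mul_trunc_pow (f : R⟦X⟧) {n k : ℕ} (hkn : k ≤ n) :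
    coeff n ((X * f) ^ k) = coeff n ((X * (trunc (n - k + 1) f : R⟦X⟧)) ^ k) := by
  have htrunc := congrArg (Polynomial.coeff · (n - k)) (trunc_trunc_pow f (n - k + 1) k)
  simp only [coeff_trunc, if_pos (Nat.lt_succ_self (n - k))] at htrunc
  rw [mul_pow, mul_pow, coeff_X_pow_mul', coeff_X_pow_mul', if_pos hkn, if_pos hkn, htrunc]

theorem factorial_div_prod_eq {s : Finset ℕ} {α : ℕ → ℕ} {k : ℕ} (hα : ∑ i ∈ s, α i = k) (n : ℕ) :
    (n.factorial : ℚ) / ∏ i ∈ s, ((α i).factorial : ℚ) =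
      n.factorial / k.factorial * Nat.multinomial s α := by
  have hspec : (∏ i ∈ s, ((α i).factorial : ℚ)) * Nat.multinomial s α = k.factorial := by
    exact_mod_cast hα ▸ Nat.multinomial_spec s α
  have hprod : ∏ i ∈ s, ((α i).factorial : ℚ) ≠ 0 :=
    prod_ne_zero_iff.2 fun i _ => by positivity
  have hk : (k.factorial : ℚ) ≠ 0 := by positivity
  rw [div_mul_eq_mul_div, div_eq_div_iff hprod hk, ← hspec]
  ring

theorem partialBell_factorial_mul {n k : ℕ} (hkn : k ≤ n) (c : ℕ → ℚ) :
    partialBell n k (fun i => (i.factorial : ℚ) * c (i - 1)) =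
      n.factorial / k.factorial * coeff n ((X * mk c) ^ k) := by
  rw [coeff_X_mul_pow_eq_coeff_X_mul_trunc_pow _ hkn, X_mul_trunc_mk, coeff_sum_monomial_pow,
    mul_sum, partialBell]
  refine sum_congr rfl fun α hα => ?_
  rw [factorial_div_prod_eq (mem_piAntidiag.1 (mem_filter.1 hα).1).1, mul_assoc]
  congr 2
  refine prod_congr rfl fun i _ => ?_
  rw [mul_div_cancel_left₀ _ (by positivity)]

end PartialBell

section Counting

open PowerSeries
open Finset hiding mk

theorem ncard_eq_sum_ncard_fiber {α β : Type*} {s : Set α} (hs : s.Finite)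
    (f : α → β) {t : Finset β} (hf : ∀ a ∈ s, f a ∈ t) :
    s.ncard = ∑ b ∈ t, {a ∈ s | f a = b}.ncard := by
  classical
  lift s to Finset α using hs
  rw [Set.ncard_coe_finset, card_eq_sum_card_fiberwise hf]
  refine sum_congr rfl fun b _ => ?_
  rw [← Set.ncard_coe_finset, coe_filter]
  rfl

theorem coeff_X_pow_mul_compositionSeries_pow {n k : ℕ} (hkn : k < n) :
    coeff n (X ^ k * compositionSeries ℚ ^ n) =
      n * ∑ j ∈ Icc 1 (n - k), (1 / (j : ℚ)) * ((n - k - 1).choose (j - 1) : ℚ) *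
        ((n + j - 1).choose (j - 1) : ℚ) := by
  rw [coeff_X_pow_mul', if_pos hkn.le, coeff_compositionSeries_pow (by lia) (by lia), mul_sum]
  refine sum_congr rfl fun j hj => ?_
  obtain ⟨i, rfl⟩ := Nat.exists_eq_add_of_le' (mem_Icc.1 hj).1
  have hchoose : ((n + i).choose (i + 1) : ℚ) * (i + 1) = (n + i).choose i * n := by
    exact_mod_cast (Nat.choose_succ_right_eq (n + i) i).trans (by rw [Nat.add_sub_cancel])
  simp only [Nat.add_sub_cancel, ← Nat.add_assoc]
  push_cast
  field_simp
  linear_combination ((n - k - 1).choose i : ℚ) * hchoose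

namespace OrderedTree

theorem ncard_withGenerators_numUnary_pred_eq_sum {n k : ℕ} (hk : 1 ≤ k) (hkn : k < n) :
    ({t ∈ withGenerators n | t.numUnary = k - 1}.ncard : ℚ) =
      n.choose (k - 1) * ∑ j ∈ Icc 1 (n - k),
        (1 / (j : ℚ)) * ((n - k - 1).choose (j - 1) : ℚ) * ((n + j - 1).choose (j - 1) : ℚ) := by
  have hn : (n : ℚ) ≠ 0 := Nat.cast_ne_zero.2 (by lia)
  apply mul_left_cancel₀ hn
  rw [natCast_mul_ncard_withGenerators_numUnary, Nat.sub_add_cancel hk,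
    coeff_X_pow_mul_compositionSeries_pow hkn]
  ring

theorem ncard_withGenerators_numUnary_pred_self {n : ℕ} (hn : 1 ≤ n) :
    {t ∈ withGenerators n | t.numUnary = n - 1}.ncard = 1 := by
  have hcount := natCast_mul_ncard_withGenerators_numUnary n (n - 1)
  have hcoeff : coeff 0 (compositionSeries ℚ ^ n) = 1 := by
    have := congrArg constantCoeff (compositionSeries_mul_one_sub_two_mul_X (R := ℚ))
    simp_all
  rw [Nat.sub_add_cancel hn, coeff_X_pow_mul', if_pos le_rfl, Nat.sub_self, hcoeff, mul_one,
    Nat.choose_symm hn, Nat.choose_one_right] at hcount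
  exact_mod_cast mul_right_eq_self₀.1 hcount |>.resolve_right (Nat.cast_ne_zero.2 (by lia))

theorem ncard_withGenerators_eq_sum_ncard_numUnary_pred (n : ℕ) :
    (withGenerators n).ncard =
      ∑ k ∈ Icc 1 n, {t ∈ withGenerators n | t.numUnary = k - 1}.ncard := by
  rw [ncard_eq_sum_ncard_fiber (finite_withGenerators n) (fun t => t.numUnary + 1) (t := Icc 1 n)]
  · refine sum_congr rfl fun k hk => ?_
    have hpred (u : ℕ) : u + 1 = k ↔ u = k - 1 := by have := mem_Icc.1 hk; lia
    simp only [hpred]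
  · rintro t rfl
    exact mem_Icc.2 ⟨Nat.le_add_left _ _, t.numUnary_lt_numGenerators⟩

theorem ncard_withGenerators_eq_one_add_sum {n : ℕ} (hn : 1 ≤ n) :
    ((withGenerators n).ncard : ℚ) =
      1 + ∑ k ∈ Icc 1 (n - 1), ∑ j ∈ Icc 1 (n - k),
        (1 / (j : ℚ)) * (n.choose (k - 1) : ℚ) * ((n - k - 1).choose (j - 1) : ℚ) *
          ((n + j - 1).choose (j - 1) : ℚ) := by
  have hsplit := sum_Icc_succ_top (Nat.le_add_left 1 (n - 1))
    fun k => {t ∈ withGenerators n | t.numUnary = k - 1}.ncard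
  rw [Nat.sub_add_cancel hn, ncard_withGenerators_numUnary_pred_self hn] at hsplit
  rw [ncard_withGenerators_eq_sum_ncard_numUnary_pred, hsplit, add_comm, Nat.cast_add,
    Nat.cast_one, Nat.cast_sum]
  refine congrArg _ (sum_congr rfl fun k hk => ?_)
  obtain ⟨hk, hkn⟩ := mem_Icc.1 hk
  rw [ncard_withGenerators_numUnary_pred_eq_sum hk (by lia), mul_sum]
  exact sum_congr rfl fun j _ => by ring

theorem map_ncard_withGenerators_range_eight :
    (List.range 8).map (fun i => (withGenerators (i + 1)).ncard) =
      [1, 2, 7, 32, 166, 926, 5419, 32816] := by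
  have hvalue (n v : ℕ) (hn : 1 ≤ n)
      (hv : 1 + ∑ k ∈ Icc 1 (n - 1), ∑ j ∈ Icc 1 (n - k),
        (1 / (j : ℚ)) * (n.choose (k - 1) : ℚ) * ((n - k - 1).choose (j - 1) : ℚ) *
          ((n + j - 1).choose (j - 1) : ℚ) = v) : (withGenerators n).ncard = v := by
    rw [← ncard_withGenerators_eq_one_add_sum hn] at hv
    exact_mod_cast hv
  rw [show List.range 8 = [0, 1, 2, 3, 4, 5, 6, 7] from rfl]
  simp only [List.map_cons, List.map_nil, Nat.reduceAdd]
  rw [hvalue 1 1, hvalue 2 2, hvalue 3 7, hvalue 4 32, hvalue 5 166, hvalue 6 926, hvalue 7 5419,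
    hvalue 8 32816] <;> norm_num [sum_Icc_succ_top, Nat.choose]

theorem natCast_mul_ncard_withGenerators_numUnary_pred {n k : ℕ} (hn : 1 ≤ n) (hk : 1 ≤ k) :
    (k : ℚ) * {t ∈ withGenerators n | t.numUnary = k - 1}.ncard =
      n.choose (k - 1) * coeff n ((X * littleSchroderSeries) ^ k) := by
  have hn' : (n : ℚ) ≠ 0 := Nat.cast_ne_zero.2 (by lia)
  have hcount := natCast_mul_ncard_withGenerators_numUnary n (k - 1)
  rw [Nat.sub_add_cancel hk] at hcount
  apply mul_left_cancel₀ hn'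
  linear_combination (k : ℚ) * hcount -
    (n.choose (k - 1) : ℚ) * natCast_mul_coeff_X_mul_littleSchroderSeries_pow k n

theorem ncard_withGenerators_numUnary_pred_eq_partialBell {n k : ℕ} (hk : 1 ≤ k) (hkn : k ≤ n) :
    ({t ∈ withGenerators n | t.numUnary = k - 1}.ncard : ℚ) =
      n.choose (k - 1) * ((k - 1).factorial / n.factorial) *
        partialBell n k (fun i => (i.factorial : ℚ) * (littleSchroder (i - 1) : ℚ)) := by
  have hk' : (k : ℚ) ≠ 0 := Nat.cast_ne_zero.2 (by lia)
  have hn : (n.factorial : ℚ) ≠ 0 := by positivity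
  have hfactorial : (k.factorial : ℚ) = k * (k - 1).factorial := by
    exact_mod_cast (Nat.mul_factorial_pred (by lia)).symm
  rw [partialBell_factorial_mul hkn fun i => (littleSchroder i : ℚ), hfactorial]
  apply mul_left_cancel₀ hk'
  rw [natCast_mul_ncard_withGenerators_numUnary_pred (hk.trans hkn) hk, littleSchroderSeries]
  field_simp

end OrderedTree

theorem natCast_mul_ncard_schroderDyckPaths_dyckPeaks (n : ℕ) {k : ℕ} (hk : 1 ≤ k) :
    (k : ℚ) * {P ∈ schroderDyckPaths n | dyckPeaks P.path = k}.ncard =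
      n.choose (k - 1) * coeff n ((X * littleSchroderSeries) ^ k) := by
  have hcount := ColoredDyckPath.natCast_mul_ncard_semilength_peaks
    (fun j => littleSchroder (j - 1)) n k
  have hchoose : ((n + 1 : ℕ) : ℚ) * n.choose (k - 1) = (n + 1).choose k * k := by
    obtain ⟨u, rfl⟩ := Nat.exists_eq_add_of_le' hk
    exact_mod_cast Nat.add_one_mul_choose_eq n u
  apply mul_left_cancel₀ (Nat.cast_ne_zero.2 n.succ_ne_zero : ((n + 1 : ℕ) : ℚ) ≠ 0)
  simp only [Nat.add_sub_cancel] at hcount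
  rw [littleSchroderSeries, ← mul_assoc _ (n.choose _ : ℚ), hchoose, mul_left_comm]
  exact (congrArg _ hcount).trans (by ring)

theorem finite_schroderDyckPaths (n : ℕ) : (schroderDyckPaths n).Finite :=
  ColoredDyckPath.finite_semilength_eq _ n

theorem ncard_schroderDyckPaths_eq_sum_ncard_dyckPeaks {n : ℕ} (hn : 1 ≤ n) :
    (schroderDyckPaths n).ncard =
      ∑ k ∈ Icc 1 n, {P ∈ schroderDyckPaths n | dyckPeaks P.path = k}.ncard := by
  refine ncard_eq_sum_ncard_fiber (finite_schroderDyckPaths n) _ ?_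
  rintro P rfl
  exact mem_Icc.2 ⟨dyckPeaks_pos hn, dyckPeaks_le_semilength P.path⟩

theorem ncard_withGenerators_numUnary_pred_eq_ncard_dyckPeaks {n k : ℕ} (hn : 1 ≤ n)
    (hk : 1 ≤ k) :
    {t ∈ OrderedTree.withGenerators n | t.numUnary = k - 1}.ncard =
      {P ∈ schroderDyckPaths n | dyckPeaks P.path = k}.ncard := by
  have hk' : (k : ℚ) ≠ 0 := Nat.cast_ne_zero.2 (by lia)
  exact_mod_cast mul_left_cancel₀ hk'
    ((OrderedTree.natCast_mul_ncard_withGenerators_numUnary_pred hn hk).trans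
      (natCast_mul_ncard_schroderDyckPaths_dyckPeaks n hk).symm)

theorem ncard_withGenerators_eq_ncard_schroderDyckPaths {n : ℕ} (hn : 1 ≤ n) :
    (OrderedTree.withGenerators n).ncard = (schroderDyckPaths n).ncard := by
  rw [OrderedTree.ncard_withGenerators_eq_sum_ncard_numUnary_pred,
    ncard_schroderDyckPaths_eq_sum_ncard_dyckPeaks hn]
  exact sum_congr rfl fun k hk =>
    ncard_withGenerators_numUnary_pred_eq_ncard_dyckPeaks hn (mem_Icc.1 hk).1

end Counting

theorem mainTheorem9 :
    (∀ n : ℕ, 1 ≤ n →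
      (OrderedTree.withGenerators n).Finite ∧
      (schroderDyckPaths n).Finite ∧
      (OrderedTree.withGenerators n).ncard = (schroderDyckPaths n).ncard ∧
      ((OrderedTree.withGenerators n).ncard : ℚ) =
        1 + ∑ k ∈ Finset.Icc 1 (n - 1), ∑ j ∈ Finset.Icc 1 (n - k),
          (1 / (j : ℚ)) * (n.choose (k - 1) : ℚ) * ((n - k - 1).choose (j - 1) : ℚ) *
            ((n + j - 1).choose (j - 1) : ℚ) ∧
      (∀ k : ℕ, 1 ≤ k →
        {t ∈ OrderedTree.withGenerators n | t.numUnary = k - 1}.ncard =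
          {P ∈ schroderDyckPaths n | dyckPeaks P.path = k}.ncard) ∧
      (∀ k : ℕ, 1 ≤ k → k ≤ n →
        ({t ∈ OrderedTree.withGenerators n | t.numUnary = k - 1}.ncard : ℚ) =
          (n.choose (k - 1) : ℚ) * (((k - 1).factorial : ℚ) / (n.factorial : ℚ)) *
            partialBell n k (fun i => (i.factorial : ℚ) * (littleSchroder (i - 1) : ℚ))) ∧
      (∀ k : ℕ, 1 ≤ k → k < n →
        ({t ∈ OrderedTree.withGenerators n | t.numUnary = k - 1}.ncard : ℚ) =
          (n.choose (k - 1) : ℚ) *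
            ∑ j ∈ Finset.Icc 1 (n - k),
              (1 / (j : ℚ)) * ((n - k - 1).choose (j - 1) : ℚ) *
                ((n + j - 1).choose (j - 1) : ℚ))) ∧
    (List.range 8).map (fun i => (OrderedTree.withGenerators (i + 1)).ncard) =
      [1, 2, 7, 32, 166, 926, 5419, 32816] := by
  refine ⟨fun n hn => ⟨OrderedTree.finite_withGenerators n, finite_schroderDyckPaths n,
    ncard_withGenerators_eq_ncard_schroderDyckPaths hn,
    OrderedTree.ncard_withGenerators_eq_one_add_sum hn,
    fun k hk => ncard_withGenerators_numUnary_pred_eq_ncard_dyckPeaks hn hk,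
    fun k hk hkn => OrderedTree.ncard_withGenerators_numUnary_pred_eq_partialBell hk hkn,
    fun k hk hkn => OrderedTree.ncard_withGenerators_numUnary_pred_eq_sum hk hkn⟩,
    OrderedTree.map_ncard_withGenerators_range_eight⟩
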